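/- Let $d\ge 0$, $k\ge 1$ be integers and, for $m\ge 1$, let $C_0^m(\mathbb R^d,\mathbb R^d)$ be the Banach space of $C^m$ maps all of whose derivatives of order $0,\dots,m$ vanish at infinity, with norm $\max_{i\le m}\sup_x\|D^iu(x)\|$, and $$\operatorname{Diff}_{C_0^m}(\mathbb R^d)=(\mathrm{id}+C_0^m(\mathbb R^d,\mathbb R^d))\cap\operatorname{Diff}^1(\mathbb R^d),$$ a group under composition and an open subset of the affine Banach space $\mathrm{id}+C_0^m(\mathbb R^d,\mathbb R^d)$, hence a Banach manifold. Let $G$ be a finite-dimensional real Lie group acting smoothly (i.e. $C^\infty$) on $\mathbb R^d$. Assume that for each $m\ge k$ this action lifts to a right action $\rho$ of $G$ on $\operatorname{Diff}_{C_0^m}(\mathbb R^d)$, that is: $\rho_g$ is a group automorphism and a smooth diffeomorphism of $\operatorname{Diff}_{C_0^m}(\mathbb R^d)$, $\rho_{gh}=\rho_h\circ\rho_g$, the map $(g,\varphi)\mapsto\rho_g(\varphi)$ is continuous, and $\rho_g(\varphi)(x)=g^{-1}\cdot\varphi(g\cdot x)$ for all $x\in\mathbb R^d$. Let $\mathcal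 G^m=G\ltimes\operatorname{Diff}_{C_0^m}(\mathbb R^d)$ be the product manifold with the group law $(g,\varphi)(g',\varphi')=(gg',\rho_{g'}(\varphi)\circ\varphi')$. Let $\mathcal Q$ be a smooth Banach manifold on which $\operatorname{Diff}_{C_0^k}(\mathbb R^d)$ acts in such a way that * the action $(\varphi,q)\mapsto\varphi\cdot q$ is continuous; * for each $q\in\mathcal Q$ the map $\varphi\mapsto\varphi\cdot q$ is smooth; write $u\cdot q=\partial_\varphi|_{\varphi=\mathrm{id}}(\varphi\cdot q)(u)\in T_q\mathcal Q$ for $u\in C_0^k(\mathbb R^d,\mathbb R^d)$; * for every integer $l>0$ the maps $\operatorname{Diff}_{C_0^{k+l}}(\mathbb R^d)\times\mathcal Q\to\mathcal Q$, $(\varphi,q)\mapsto\varphi\cdot q$, and $C_0^{k+l}(\mathbb R^d,\mathbb R^d)\times\mathcal Q\to T\mathcal Q$, $(u,q)\mapsto u\cdot q$, are $C^l$. Let $G$ also act smoothly on $\mathcal Q$, with $\varphi\cdot(g\cdot q)=g\cdot(\rho_g(\varphi)\cdot q)$ for all $g\in G$, $\varphi\in\operatorname{Diff}_{C_0^k}(\mathbb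 R^d)$, $q\in\mathcal Q$, and write $X\cdot q=\partial_g|_{g=e}(g\cdot q)(X)\in T_q\mathcal Q$ for $X\in\mathfrak g=T_eG$. Put $\tilde{\mathcal Q}=G\times\mathcal Q$ and $$A:\mathcal G^k\times\tilde{\mathcal Q}\to\tilde{\mathcal Q},\qquad A\big((g,\varphi),(h,q)\big)=\big(gh,\;g\cdot(\varphi\cdot q)\big).$$ Then $A$ is an action of the group $\mathcal G^k$ on $\tilde{\mathcal Q}$, and: 1. $A$ is continuous. 2. For every $(h,q)\in\tilde{\mathcal Q}$ the orbit map $A_{(h,q)}:\mathcal G^k\to\tilde{\mathcal Q}$, $\gamma\mapsto A(\gamma,(h,q))$, is smooth, and its derivative $\xi_{(h,q)}=d_{(e,\mathrm{id})}A_{(h,q)}$ is $\xi_{(h,q)}(X,u)=(Xh,\;X\cdot q+u\cdot q)$ for $(X,u)\in\mathfrak g\times C_0^k(\mathbb R^d,\mathbb R^d)=T_{(e,\mathrm{id})}\mathcal G^k$, where $Xh=d_eR_h(X)$ and $R_h(g)=gh$. 3. For every integer $l>0$ the restricted action $A:\mathcal G^{k+l}\times\tilde{\mathcal Q}\to\tilde{\mathcal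 Q}$ and the infinitesimal action $\xi:T_{(e,\mathrm{id})}\mathcal G^{k+l}\times\tilde{\mathcal Q}\to T\tilde{\mathcal Q}$, $((X,u),(h,q))\mapsto\xi_{(h,q)}(X,u)$, are $C^l$. -/

import Mathlib

open Set Filter Topology
open scoped Manifold ContDiff NNReal

noncomputable section

namespace ShapeSpace

/-- The Euclidean space `ℝ^d`. -/
abbrev Eucl (d : ℕ) : Type := EuclideanSpace ℝ (Fin d)

/-! ### The Banach space `C_0^k(ℝ^d, ℝ^d)` -/

/-- `C^k` maps of `ℝ^d` into itself all of whose derivatives of order `0, …, k` vanish at infinity. -/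
def c0Submodule (d k : ℕ) : Submodule ℝ (Eucl d → Eucl d) where
  carrier := {f | ContDiff ℝ k f ∧
    ∀ i ≤ k, Tendsto (iteratedFDeriv ℝ i f) (cocompact (Eucl d)) (𝓝 0)}
  zero_mem' := by
    refine ⟨contDiff_const, fun i _ => ?_⟩
    have : iteratedFDeriv ℝ i (0 : Eucl d → Eucl d) = 0 := iteratedFDeriv_fun_zero
    rw [this]
    exact tendsto_const_nhds
  add_mem' := by
    rintro f g ⟨hf, hf'⟩ ⟨hg, hg'⟩
    refine ⟨hf.add hg, fun i hi => ?_⟩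
    have hi' : (i : WithTop ℕ∞) ≤ k := by exact_mod_cast hi
    rw [iteratedFDeriv_add (hf.of_le hi') (hg.of_le hi')]
    have h := (hf' i hi).add (hg' i hi)
    rw [add_zero] at h
    exact h
  smul_mem' := by
    rintro c f ⟨hf, hf'⟩
    refine ⟨contDiff_const.smul hf, fun i hi => ?_⟩
    have hi' : (i : WithTop ℕ∞) ≤ k := by exact_mod_cast hi
    have : iteratedFDeriv ℝ i (c • f) = c • iteratedFDeriv ℝ i f := by
      funext x
      exact iteratedFDeriv_const_smul_apply ((hf.of_le hi').contDiffAt)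
    rw [this]
    have h := (hf' i hi).const_smul c
    rw [smul_zero] at h
    exact h

/-- The space `C_0^k(ℝ^d, ℝ^d)`. -/
def C0Map (d k : ℕ) : Type := c0Submodule d k

namespace C0Map

variable {d k : ℕ}

instance : AddCommGroup (C0Map d k) := inferInstanceAs (AddCommGroup (c0Submodule d k))
instance : Module ℝ (C0Map d k) := inferInstanceAs (Module ℝ (c0Submodule d k))

instance : FunLike (C0Map d k) (Eucl d) (Eucl d) where
  coe u := u.1
  coe_injective _ _ h := Subtype.ext h

theorem contDiff (u : C0Map d k) : ContDiff ℝ k u := u.2.1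

theorem tendsto (u : C0Map d k) {i : ℕ} (hi : i ≤ k) :
    Tendsto (iteratedFDeriv ℝ i u) (cocompact (Eucl d)) (𝓝 0) := u.2.2 i hi

theorem contDiff_of_le (u : C0Map d k) {i : ℕ} (hi : i ≤ k) : ContDiff ℝ i u :=
  u.contDiff.of_le (by exact_mod_cast hi)

@[simp] theorem coe_add (u v : C0Map d k) : ⇑(u + v) = u + v := rfl
@[simp] theorem coe_sub (u v : C0Map d k) : ⇑(u - v) = u - v := rfl
@[simp] theorem coe_zero : ⇑(0 : C0Map d k) = 0 := rfl
@[simp] theorem coe_smul (c : ℝ) (u : C0Map d k) : ⇑(c • u) = c • ⇑u := rfl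

/-- The collection of all derivatives of order at most `k`, as continuous functions vanishing at
infinity. -/
def jet (d k : ℕ) : C0Map d k →ₗ[ℝ]
    ((i : Fin (k + 1)) → ZeroAtInftyContinuousMap (Eucl d) (Eucl d [×i]→L[ℝ] Eucl d)) where
  toFun u i :=
    { toFun := iteratedFDeriv ℝ i u
      continuous_toFun :=
        (u.contDiff_of_le (Nat.lt_succ_iff.1 i.2)).continuous_iteratedFDeriv le_rfl
      zero_at_infty' := u.tendsto (Nat.lt_succ_iff.1 i.2) }
  map_add' u v := by
    funext i
    ext1 x
    exact iteratedFDeriv_add_apply ((u.contDiff_of_le (Nat.lt_succ_iff.1 i.2)).contDiffAt)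
      ((v.contDiff_of_le (Nat.lt_succ_iff.1 i.2)).contDiffAt)
  map_smul' c u := by
    funext i
    ext1 x
    exact iteratedFDeriv_const_smul_apply
      ((u.contDiff_of_le (Nat.lt_succ_iff.1 i.2)).contDiffAt)

theorem jet_injective : Function.Injective (jet d k) := by
  intro u v h
  apply DFunLike.coe_injective
  funext x
  have h0 := DFunLike.congr_fun (congrFun h 0) x
  have h1 : iteratedFDeriv ℝ 0 u x = iteratedFDeriv ℝ 0 v x := h0
  simpa using DFunLike.congr_fun h1 0

/-- The `C^k` norm `max_{i ≤ k} sup_x ‖D^i u(x)‖`. -/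
instance : NormedAddCommGroup (C0Map d k) :=
  NormedAddCommGroup.induced _ _ (jet d k) jet_injective

instance : NormedSpace ℝ (C0Map d k) := NormedSpace.induced ℝ _ _ (jet d k)

theorem norm_def (u : C0Map d k) : ‖u‖ = ‖jet d k u‖ := rfl

theorem norm_iteratedFDeriv_le (u : C0Map d k) {i : ℕ} (hi : i ≤ k) (x : Eucl d) :
    ‖iteratedFDeriv ℝ i u x‖ ≤ ‖u‖ := by
  have h1 := norm_le_pi_norm (jet d k u) ⟨i, Nat.lt_succ_iff.2 hi⟩
  refine le_trans ?_ h1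
  exact (jet d k u ⟨i, Nat.lt_succ_iff.2 hi⟩).toBCF.norm_coe_le_norm x

theorem norm_fderiv_le (u : C0Map d k) (hk : 1 ≤ k) (x : Eucl d) :
    ‖fderiv ℝ u x‖ ≤ ‖u‖ := by
  rw [← norm_iteratedFDeriv_one]
  exact u.norm_iteratedFDeriv_le hk x

/-- The inclusion `C_0^{m}(ℝ^d, ℝ^d) → C_0^k(ℝ^d, ℝ^d)` for `k ≤ m`. -/
def incl {m : ℕ} (h : k ≤ m) : C0Map d m →ₗ[ℝ] C0Map d k where
  toFun u := ⟨u, u.contDiff_of_le h, fun _ hi => u.tendsto (hi.trans h)⟩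
  map_add' _ _ := rfl
  map_smul' _ _ := rfl

@[simp] theorem coe_incl {m : ℕ} (h : k ≤ m) (u : C0Map d m) : ⇑(incl h u) = u := rfl

end C0Map

/-! ### The group `Diff_{C_0^k}(ℝ^d)` -/

/-- `C^1`-diffeomorphisms of `ℝ^d`. -/
def IsC1Diffeo {d : ℕ} (f : Eucl d → Eucl d) : Prop :=
  ContDiff ℝ 1 f ∧ ∃ g : Eucl d → Eucl d,
    ContDiff ℝ 1 g ∧ Function.LeftInverse g f ∧ Function.RightInverse g f

section Aux

variable {d k : ℕ}

theorem C0Map.exists_bound_id_add (u : C0Map d k) : ∃ D : ℝ, 1 ≤ D ∧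
    ∀ i, 1 ≤ i → i ≤ k → ∀ x, ‖iteratedFDeriv ℝ i (fun x => x + u x) x‖ ≤ D := by
  refine ⟨1 + ‖u‖, by simp, fun i hi hik x => ?_⟩
  have h1 : iteratedFDeriv ℝ i (fun x => x + u x) x
      = iteratedFDeriv ℝ i (fun x : Eucl d => x) x + iteratedFDeriv ℝ i u x :=
    iteratedFDeriv_add_apply contDiff_id.contDiffAt (u.contDiff_of_le hik).contDiffAt
  rw [h1]
  refine (norm_add_le _ _).trans (add_le_add ?_ (u.norm_iteratedFDeriv_le hik x))
  obtain ⟨j, rfl⟩ : ∃ j, i = j + 1 := ⟨i - 1, by omega⟩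
  rw [← norm_iteratedFDeriv_fderiv]
  have h2 : fderiv ℝ (fun x : Eucl d => x) = fun _ => ContinuousLinearMap.id ℝ (Eucl d) := by
    funext y
    exact fderiv_fun_id
  rw [h2]
  rcases Nat.eq_zero_or_pos j with rfl | hj
  · rw [norm_iteratedFDeriv_zero]
    exact ContinuousLinearMap.norm_id_le
  · rw [iteratedFDeriv_const_of_ne hj.ne']
    simp

theorem C0Map.comp_mem (u : C0Map d k) {f : Eucl d → Eucl d} (hf : ContDiff ℝ k f) {D : ℝ}
    (hD1 : 1 ≤ D) (hD : ∀ i, 1 ≤ i → i ≤ k → ∀ x, ‖iteratedFDeriv ℝ i f x‖ ≤ D)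
    (hf' : Tendsto f (cocompact _) (cocompact _)) : (u ∘ f) ∈ c0Submodule d k := by
  refine ⟨u.contDiff.comp hf, fun n hn => ?_⟩
  rw [tendsto_zero_iff_norm_tendsto_zero]
  have hb : ∀ x, ‖iteratedFDeriv ℝ n (u ∘ f) x‖ ≤
      n.factorial * (∑ i ∈ Finset.range (k + 1), ‖iteratedFDeriv ℝ i u (f x)‖) * D ^ n := by
    intro x
    refine norm_iteratedFDeriv_comp_le u.contDiff hf (by exact_mod_cast hn) x ?_ ?_
    · intro i hi
      exact Finset.single_le_sum (f := fun i => ‖iteratedFDeriv ℝ i u (f x)‖)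
        (fun _ _ => norm_nonneg _) (Finset.mem_range.2 (by omega))
    · intro i hi hin
      exact (hD i hi (hin.trans hn) x).trans (le_self_pow₀ hD1 (by omega))
  refine squeeze_zero (fun _ => norm_nonneg _) hb ?_
  have h0 : Tendsto (fun x => ∑ i ∈ Finset.range (k + 1), ‖iteratedFDeriv ℝ i u (f x)‖)
      (cocompact _) (𝓝 (∑ i ∈ Finset.range (k + 1), 0)) := by
    refine tendsto_finsetSum _ fun i hi => ?_
    have := (u.tendsto (Nat.lt_succ_iff.1 (Finset.mem_range.1 hi))).comp hf'
    exact tendsto_zero_iff_norm_tendsto_zero.1 this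
  have h1 := (h0.const_mul (n.factorial : ℝ)).mul_const (D ^ n)
  simpa using h1

theorem IsC1Diffeo.fderiv_isUnit {f : Eucl d → Eucl d} {g : Eucl d → Eucl d}
    (hf : ContDiff ℝ 1 f) (hg : ContDiff ℝ 1 g) (hl : Function.LeftInverse g f)
    (hr : Function.RightInverse g f) (x : Eucl d) :
    ∃ e : (Eucl d →L[ℝ] Eucl d)ˣ, (e : Eucl d →L[ℝ] Eucl d) = fderiv ℝ f x ∧
      ((e⁻¹ : (Eucl d →L[ℝ] Eucl d)ˣ) : Eucl d →L[ℝ] Eucl d) = fderiv ℝ g (f x) := by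
  have hfd : ∀ x, HasFDerivAt f (fderiv ℝ f x) x := fun x =>
    (hf.differentiable one_ne_zero x).hasFDerivAt
  have hgd : ∀ x, HasFDerivAt g (fderiv ℝ g x) x := fun x =>
    (hg.differentiable one_ne_zero x).hasFDerivAt
  have h1 := (hgd (f x)).comp x (hfd x)
  have e1 : g ∘ f = id := funext hl
  rw [e1] at h1
  have h2 := ((hl x).symm ▸ hfd x : HasFDerivAt f (fderiv ℝ f x) (g (f x))).comp (f x) (hgd (f x))
  have e2 : f ∘ g = id := funext hr
  rw [e2] at h2
  exact ⟨⟨fderiv ℝ f x, fderiv ℝ g (f x), h2.unique (hasFDerivAt_id _),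
    h1.unique (hasFDerivAt_id _)⟩, rfl, rfl⟩

theorem C0Map.contDiff_id_add (u : C0Map d k) : ContDiff ℝ k (fun x => x + u x) :=
  contDiff_id.add u.contDiff

/-- The inverse of `id + u` is `C^k` with bounded derivatives. -/
theorem C0Map.inverse_bound (hk : 1 ≤ k) (u : C0Map d k) {g : Eucl d → Eucl d}
    (hg : ContDiff ℝ 1 g) (hl : Function.LeftInverse g (fun x => x + u x))
    (hr : Function.RightInverse g (fun x => x + u x)) :
    ContDiff ℝ k g ∧ Tendsto g (cocompact _) (cocompact _) ∧ ∃ D : ℝ, 1 ≤ D ∧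
      ∀ i, 1 ≤ i → i ≤ k → ∀ x, ‖iteratedFDeriv ℝ i g x‖ ≤ D := by
  set f : Eucl d → Eucl d := fun x => x + u x with hfdef
  have hfk : ContDiff ℝ k f := u.contDiff_id_add
  have hf : ContDiff ℝ 1 f := hfk.of_le (by exact_mod_cast hk)
  let Φ : Eucl d ≃ₜ Eucl d :=
    { toFun := f, invFun := g, left_inv := hl, right_inv := hr,
      continuous_toFun := hf.continuous, continuous_invFun := hg.continuous }
  choose e he he' using IsC1Diffeo.fderiv_isUnit hf hg hl hr
  have hgk : ContDiff ℝ k g := by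
    refine Φ.contDiff_symm (f₀' := fun x => ContinuousLinearEquiv.unitsEquiv ℝ (Eucl d) (e x))
      (fun a => ?_) hfk
    have : ((ContinuousLinearEquiv.unitsEquiv ℝ (Eucl d) (e a) : Eucl d ≃L[ℝ] Eucl d) :
        Eucl d →L[ℝ] Eucl d) = fderiv ℝ f a := by
      rw [← he a]; rfl
    rw [this]
    exact (hf.differentiable one_ne_zero a).hasFDerivAt
  refine ⟨hgk, Φ.symm.isClosedEmbedding.tendsto_cocompact, ?_⟩
  -- the set of invertible operators, the inversion map, and the values of the derivative
  let t : Set (Eucl d →L[ℝ] Eucl d) := {a | IsUnit a}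
  have ht : IsOpen t := Units.isOpen
  let F : Eucl d → (Eucl d →L[ℝ] Eucl d) := Ring.inverse ∘ fderiv ℝ f
  have hrange : range (fderiv ℝ f) ⊆ t := by
    rintro _ ⟨x, rfl⟩
    exact ⟨e x, he x⟩
  have hinv : ContDiffOn ℝ k (Ring.inverse : (Eucl d →L[ℝ] Eucl d) → _) t := by
    rintro _ ⟨a, rfl⟩
    exact (contDiffAt_ringInverse ℝ a).contDiffWithinAt
  have hfd : ContDiff ℝ (k - 1 : ℕ) (fderiv ℝ f) := by
    refine hfk.fderiv_right ?_
    exact_mod_cast (by omega : k - 1 + 1 ≤ k)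
  have hgF : fderiv ℝ g = F ∘ g := by
    funext y
    have h1 : F (g y) = fderiv ℝ g (f (g y)) := by
      change Ring.inverse (fderiv ℝ f (g y)) = _
      rw [← he, ← he', Ring.inverse_unit]
    rw [Function.comp_apply, h1, hr y]
  -- derivatives of inversion are bounded on the values of the derivative
  have hlim : Tendsto (fderiv ℝ f) (cocompact _) (𝓝 1) := by
    have h1 : fderiv ℝ f = fun x => 1 + fderiv ℝ u x := by
      funext x
      have := (hasFDerivAt_id x).add
        ((u.contDiff_of_le hk).differentiable one_ne_zero x).hasFDerivAt
      exact this.fderiv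
    have h2 : Tendsto (fderiv ℝ u) (cocompact _) (𝓝 0) := by
      rw [tendsto_zero_iff_norm_tendsto_zero]
      have := tendsto_zero_iff_norm_tendsto_zero.1 (u.tendsto hk)
      simpa only [norm_iteratedFDeriv_one] using this
    rw [h1]
    simpa using h2.const_add (1 : Eucl d →L[ℝ] Eucl d)
  have hCinv : ∀ i, i ≤ k → ∃ C, ∀ x,
      ‖iteratedFDerivWithin ℝ i (Ring.inverse : (Eucl d →L[ℝ] Eucl d) → _) t (fderiv ℝ f x)‖
        ≤ C := by
    intro i hi
    have hc : ContinuousOn (iteratedFDerivWithin ℝ i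
        (Ring.inverse : (Eucl d →L[ℝ] Eucl d) → _) t) t :=
      hinv.continuousOn_iteratedFDerivWithin (by exact_mod_cast hi) ht.uniqueDiffOn
    have h1t : (1 : Eucl d →L[ℝ] Eucl d) ∈ t := isUnit_one
    have hl1 : Tendsto (fun x => ‖iteratedFDerivWithin ℝ i
        (Ring.inverse : (Eucl d →L[ℝ] Eucl d) → _) t (fderiv ℝ f x)‖) (cocompact _)
        (𝓝 ‖iteratedFDerivWithin ℝ i (Ring.inverse : (Eucl d →L[ℝ] Eucl d) → _) t 1‖) :=
      ((hc.continuousAt (ht.mem_nhds h1t)).tendsto.comp hlim).norm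
    have hcont : Continuous (fun x => ‖iteratedFDerivWithin ℝ i
        (Ring.inverse : (Eucl d →L[ℝ] Eucl d) → _) t (fderiv ℝ f x)‖) :=
      (hc.comp_continuous hfd.continuous fun x => hrange ⟨x, rfl⟩).norm
    have hev := hl1.eventually_le_const (lt_add_one _)
    obtain ⟨K, hK, hKs⟩ := mem_cocompact.1 hev
    obtain ⟨C, hC⟩ := hK.exists_bound_of_continuousOn hcont.continuousOn
    refine ⟨max C (‖iteratedFDerivWithin ℝ i
      (Ring.inverse : (Eucl d →L[ℝ] Eucl d) → _) t 1‖ + 1), fun x => ?_⟩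
    by_cases hx : x ∈ K
    · have := hC x hx
      rw [norm_norm] at this
      exact this.trans (le_max_left _ _)
    · exact (show _ ≤ _ from hKs hx).trans (le_max_right _ _)
  have hunif : ∀ (N : ℕ) (P : ℕ → ℝ → Prop), (∀ i C C', C ≤ C' → P i C → P i C') →
      (∀ i ≤ N, ∃ C, P i C) → ∃ C, 1 ≤ C ∧ ∀ i ≤ N, P i C := by
    intro N P hmono h
    induction N with
    | zero =>
      obtain ⟨C, hC⟩ := h 0 le_rfl
      refine ⟨max 1 C, le_max_left _ _, fun i hi => ?_⟩
      obtain rfl : i = 0 := by omega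
      exact hmono _ _ _ (le_max_right _ _) hC
    | succ N ih =>
      obtain ⟨C, h1, hC⟩ := ih fun i hi => h i (by omega)
      obtain ⟨C', hC'⟩ := h (N + 1) le_rfl
      refine ⟨max C C', h1.trans (le_max_left _ _), fun i hi => ?_⟩
      rcases Nat.lt_or_ge i (N + 1) with hlt | hge
      · exact hmono _ _ _ (le_max_left _ _) (hC i (by omega))
      · obtain rfl : i = N + 1 := by omega
        exact hmono _ _ _ (le_max_right _ _) hC'
  obtain ⟨C₁, hC₁1, hC₁⟩ := hunif k (fun i C => ∀ x, ‖iteratedFDerivWithin ℝ i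
    (Ring.inverse : (Eucl d →L[ℝ] Eucl d) → _) t (fderiv ℝ f x)‖ ≤ C)
    (fun i C C' h hP x => (hP x).trans h) hCinv
  obtain ⟨D₁, hD₁1, hD₁⟩ := u.exists_bound_id_add
  have hFk : ContDiff ℝ (k - 1 : ℕ) F :=
    contDiff_iff_contDiffAt.2 fun x => by
      have h := contDiffAt_ringInverse ℝ (n := ((k - 1 : ℕ) : WithTop ℕ∞)) (e x)
      rw [he x] at h
      exact h.comp x hfd.contDiffAt
  have hF : ∀ i, i ≤ k - 1 → ∃ C, ∀ x, ‖iteratedFDeriv ℝ i F x‖ ≤ C := by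
    intro i hi
    refine ⟨i.factorial * C₁ * D₁ ^ i, fun x => ?_⟩
    refine norm_iteratedFDeriv_comp_le' (N := ((k - 1 : ℕ) : WithTop ℕ∞)) hrange ht.uniqueDiffOn
      (hinv.of_le (by exact_mod_cast (by omega : k - 1 ≤ k))) hfd (by exact_mod_cast hi) x
      (fun j hj => hC₁ j (by omega) x) fun j hj hji => ?_
    rw [norm_iteratedFDeriv_fderiv]
    exact (hD₁ (j + 1) (by omega) (by omega) x).trans (le_self_pow₀ hD₁1 (by omega))
  obtain ⟨C₂, hC₂1, hC₂⟩ := hunif (k - 1) (fun i C => ∀ x, ‖iteratedFDeriv ℝ i F x‖ ≤ C)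
    (fun i C C' h hP x => (hP x).trans h) hF
  -- strong induction on the order of derivation
  have key : ∀ n, n ≤ k → ∃ D : ℝ, 1 ≤ D ∧
      ∀ i, 1 ≤ i → i ≤ n → ∀ x, ‖iteratedFDeriv ℝ i g x‖ ≤ D := by
    intro n
    induction n with
    | zero => exact fun _ => ⟨1, le_rfl, fun i h1 h2 => by omega⟩
    | succ n ih =>
      intro hn
      obtain ⟨D, hD1, hD⟩ := ih (by omega)
      refine ⟨max D (n.factorial * C₂ * D ^ n), hD1.trans (le_max_left _ _), fun i h1 h2 x => ?_⟩
      rcases Nat.lt_or_ge i (n + 1) with hlt | hge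
      · exact (hD i h1 (by omega) x).trans (le_max_left _ _)
      · obtain rfl : i = n + 1 := by omega
        refine le_trans ?_ (le_max_right _ _)
        rw [← norm_iteratedFDeriv_fderiv, hgF]
        refine norm_iteratedFDeriv_comp_le (N := ((k - 1 : ℕ) : WithTop ℕ∞)) hFk
          (hgk.of_le (by exact_mod_cast (by omega : k - 1 ≤ k)))
          (by exact_mod_cast (by omega : n ≤ k - 1)) x
          (fun j hj => hC₂ j (by omega) _) fun j hj hjn => ?_
        exact (hD j hj hjn x).trans (le_self_pow₀ hD1 (by omega))
  exact key k le_rfl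

theorem IsC1Diffeo.comp {f g : Eucl d → Eucl d} (hf : IsC1Diffeo f) (hg : IsC1Diffeo g) :
    IsC1Diffeo (f ∘ g) := by
  obtain ⟨hf1, f', hf', hfl, hfr⟩ := hf
  obtain ⟨hg1, g', hg', hgl, hgr⟩ := hg
  exact ⟨hf1.comp hg1, g' ∘ f', hg'.comp hf', hfl.comp hgl, hfr.comp hgr⟩

/-- A small Lipschitz perturbation of the identity is a diffeomorphism. -/
theorem isC1Diffeo_id_add {w : Eucl d → Eucl d} (hw : ContDiff ℝ 1 w)
    (hb : ∀ x, ‖fderiv ℝ w x‖ ≤ 1 / 2) : IsC1Diffeo (fun x => x + w x) := by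
  have hsm : ContDiff ℝ 1 (fun x => x + w x) := contDiff_id.add hw
  have happ : ApproximatesLinearOn (fun x => x + w x)
      ((ContinuousLinearEquiv.refl ℝ (Eucl d) : Eucl d ≃L[ℝ] Eucl d) : Eucl d →L[ℝ] Eucl d)
      univ (1 / 2 : ℝ≥0) := by
    intro x _ y _
    have h := convex_univ.norm_image_sub_le_of_norm_fderiv_le (𝕜 := ℝ) (f := w) (C := 1 / 2)
      (fun z _ => hw.differentiable one_ne_zero z) (fun z _ => hb z) (mem_univ y) (mem_univ x)
    have e : x + w x - (y + w y) - ((ContinuousLinearEquiv.refl ℝ (Eucl d) :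
        Eucl d ≃L[ℝ] Eucl d) : Eucl d →L[ℝ] Eucl d) (x - y) = w x - w y := by
      simp only [ContinuousLinearEquiv.coe_refl, ContinuousLinearMap.coe_id', id_eq]
      abel
    rw [e]
    simpa using h
  have hc : Subsingleton (Eucl d) ∨ (1 / 2 : ℝ≥0) <
      ‖((ContinuousLinearEquiv.refl ℝ (Eucl d)).symm : Eucl d →L[ℝ] Eucl d)‖₊⁻¹ := by
    rcases subsingleton_or_nontrivial (Eucl d) with h | h
    · exact Or.inl h
    · right
      have : ‖((ContinuousLinearEquiv.refl ℝ (Eucl d)).symm : Eucl d →L[ℝ] Eucl d)‖₊ = 1 := by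
        ext
        exact ContinuousLinearMap.norm_id
      rw [this, inv_one]
      exact NNReal.coe_lt_coe.1 (by norm_num)
  let Φ := happ.toHomeomorph _ hc
  have hΦ : ∀ x, Φ x = x + w x := fun _ => rfl
  have hu : ∀ x, IsUnit (1 + fderiv ℝ w x) := by
    intro x
    have h1 : ‖-fderiv ℝ w x‖ < 1 := by
      rw [norm_neg]
      exact (hb x).trans_lt (by norm_num)
    have h2 := (Units.oneSub (-fderiv ℝ w x) h1).isUnit
    simpa [Units.val_oneSub] using h2
  choose e he using hu
  have hsymm : ContDiff ℝ 1 Φ.symm := by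
    refine Φ.contDiff_symm (f₀' := fun x => ContinuousLinearEquiv.unitsEquiv ℝ (Eucl d) (e x))
      (fun a => ?_) hsm
    have : ((ContinuousLinearEquiv.unitsEquiv ℝ (Eucl d) (e a) : Eucl d ≃L[ℝ] Eucl d) :
        Eucl d →L[ℝ] Eucl d) = 1 + fderiv ℝ w a := by
      rw [← he a]; rfl
    rw [this]
    exact (hasFDerivAt_id a).add (hw.differentiable one_ne_zero a).hasFDerivAt
  exact ⟨hsm, Φ.symm, hsymm, Φ.left_inv, Φ.right_inv⟩

end Aux

/-- The set of `u ∈ C_0^k(ℝ^d, ℝ^d)` such that `id + u` is a diffeomorphism; it is open. -/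
def diffOpens (d k : ℕ) [NeZero k] : TopologicalSpace.Opens (C0Map d k) where
  carrier := {u | IsC1Diffeo fun x => x + u x}
  is_open' := by
    have hk : 1 ≤ k := NeZero.one_le
    rw [Metric.isOpen_iff]
    rintro u ⟨hu1, g, hg, hl, hr⟩
    obtain ⟨hgk, -, D, hD1, hD⟩ := u.inverse_bound hk hg hl hr
    have hDpos : 0 < D := by linarith
    refine ⟨1 / (2 * D), by positivity, fun v hv => ?_⟩
    rw [Metric.mem_ball, dist_eq_norm] at hv
    have hw1 : ContDiff ℝ 1 ((v - u : C0Map d k) ∘ g) :=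
      ((v - u).contDiff_of_le hk).comp hg
    have hb : ∀ x, ‖fderiv ℝ ((v - u : C0Map d k) ∘ g) x‖ ≤ 1 / 2 := by
      intro x
      rw [fderiv_comp x (((v - u).contDiff_of_le hk).differentiable one_ne_zero _)
        (hg.differentiable one_ne_zero x)]
      refine (ContinuousLinearMap.opNorm_comp_le _ _).trans ?_
      have h1 := (v - u).norm_fderiv_le hk (g x)
      have h2 : ‖fderiv ℝ g x‖ ≤ D := by
        rw [← norm_iteratedFDeriv_one]
        exact hD 1 le_rfl hk x
      calc _ ≤ 1 / (2 * D) * D :=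
            mul_le_mul (h1.trans hv.le) h2 (norm_nonneg _) (by positivity)
        _ = 1 / 2 := by field_simp
    have h := (isC1Diffeo_id_add hw1 hb).comp ⟨hu1, g, hg, hl, hr⟩
    have e : (fun x => x + ((v - u : C0Map d k) ∘ g) x) ∘ (fun x => x + u x)
        = fun x => x + v x := by
      funext x
      have := hl x
      simp only at this
      simp only [Function.comp_apply, this, C0Map.coe_sub, Pi.sub_apply]
      abel
    rw [e] at h
    exact h

/-- The group `Diff_{C_0^k}(ℝ^d) = (id + C_0^k(ℝ^d, ℝ^d)) ∩ Diff^1(ℝ^d)`, `k ≥ 1`. The diffeomorphism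
`φ = id + u` is represented by its displacement `u`, and the manifold structure is that of an open
subset of the Banach space `C_0^k(ℝ^d, ℝ^d)`. -/
abbrev DiffC0 (d k : ℕ) [NeZero k] : Type := diffOpens d k

namespace DiffC0

variable {d k : ℕ} [NeZero k]

instance : CoeFun (DiffC0 d k) (fun _ => Eucl d → Eucl d) where
  coe φ x := x + φ.1 x

theorem isC1Diffeo (φ : DiffC0 d k) : IsC1Diffeo φ := φ.2

theorem ext_fun {φ ψ : DiffC0 d k} (h : ∀ x, φ x = ψ x) : φ = ψ := by
  apply Subtype.ext
  apply DFunLike.coe_injective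
  funext x
  exact add_left_cancel (h x)

/-- A `C^1`-diffeomorphism `f` with `f - id ∈ C_0^k`, as an element of the group. -/
def ofFun (f : Eucl d → Eucl d) (hf : (fun x => f x - x) ∈ c0Submodule d k)
    (h : IsC1Diffeo f) : DiffC0 d k :=
  ⟨⟨fun x => f x - x, hf⟩, by
    have : (fun x => x + (f x - x)) = f := by funext x; abel
    change IsC1Diffeo (fun x => x + (f x - x))
    rwa [this]⟩

@[simp] theorem ofFun_apply (f : Eucl d → Eucl d) (hf h) (x : Eucl d) :
    (ofFun (k := k) f hf h) x = f x := by
  change x + (f x - x) = f x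
  abel

theorem tendsto_cocompact (φ : DiffC0 d k) : Tendsto φ (cocompact _) (cocompact _) := by
  obtain ⟨h1, g, hg, hl, hr⟩ := φ.2
  exact (Homeomorph.isClosedEmbedding
    { toFun := φ, invFun := g, left_inv := hl, right_inv := hr,
      continuous_toFun := h1.continuous,
      continuous_invFun := hg.continuous : Eucl d ≃ₜ Eucl d}).tendsto_cocompact

theorem comp_mem (φ ψ : DiffC0 d k) : (fun x => φ (ψ x) - x) ∈ c0Submodule d k := by
  obtain ⟨D, hD1, hD⟩ := ψ.1.exists_bound_id_add
  have h := φ.1.comp_mem ψ.1.contDiff_id_add hD1 hD ψ.tendsto_cocompact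
  have e : (fun x => φ (ψ x) - x) = (ψ.1 : Eucl d → Eucl d) + φ.1 ∘ fun x => x + ψ.1 x := by
    funext x
    simp only [Pi.add_apply, Function.comp_apply]
    abel
  rw [e]
  exact (c0Submodule d k).add_mem ψ.1.2 h

/-- The inverse function. -/
def invFun (φ : DiffC0 d k) : Eucl d → Eucl d := φ.2.2.choose

theorem invFun_contDiff (φ : DiffC0 d k) : ContDiff ℝ 1 φ.invFun := φ.2.2.choose_spec.1

theorem invFun_apply (φ : DiffC0 d k) (x : Eucl d) : φ.invFun (φ x) = x :=
  φ.2.2.choose_spec.2.1 x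

theorem apply_invFun (φ : DiffC0 d k) (x : Eucl d) : φ (φ.invFun x) = x :=
  φ.2.2.choose_spec.2.2 x

theorem inv_mem (φ : DiffC0 d k) : (fun x => φ.invFun x - x) ∈ c0Submodule d k := by
  obtain ⟨hgk, hg', D, hD1, hD⟩ :=
    φ.1.inverse_bound NeZero.one_le φ.invFun_contDiff φ.invFun_apply φ.apply_invFun
  have h := φ.1.comp_mem hgk hD1 hD hg'
  have e : (fun x => φ.invFun x - x) = -((φ.1 : Eucl d → Eucl d) ∘ φ.invFun) := by
    funext x
    have := φ.apply_invFun x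
    simp only at this
    simp only [Pi.neg_apply, Function.comp_apply]
    nth_rewrite 2 [← this]
    abel
  rw [e]
  exact (c0Submodule d k).neg_mem h

/-- The group law is composition of maps. -/
instance : Group (DiffC0 d k) where
  mul φ ψ := ofFun (fun x => φ (ψ x)) (comp_mem φ ψ) (φ.isC1Diffeo.comp ψ.isC1Diffeo)
  one := ofFun (fun x => x) (by
      have h := (c0Submodule d k).zero_mem
      simp only [sub_self]
      exact h)
    ⟨contDiff_id, id, contDiff_id, fun _ => rfl, fun _ => rfl⟩
  inv φ := ofFun φ.invFun φ.inv_mem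
    ⟨φ.invFun_contDiff, φ, φ.2.1, φ.apply_invFun, φ.invFun_apply⟩
  mul_assoc φ ψ χ := ext_fun fun x => by
    refine (ofFun_apply _ _ _ x).trans ?_
    refine (ofFun_apply _ _ _ (χ x)).trans ?_
    refine Eq.trans ?_ (ofFun_apply _ _ _ x).symm
    exact congrArg φ (ofFun_apply (fun x => ψ (χ x)) (comp_mem ψ χ) _ x).symm
  one_mul φ := ext_fun fun x => (ofFun_apply _ _ _ x).trans (ofFun_apply _ _ _ (φ x))
  mul_one φ := ext_fun fun x => (ofFun_apply _ _ _ x).trans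
    (congrArg φ (ofFun_apply (k := k) (fun x => x) _ _ x))
  inv_mul_cancel φ := ext_fun fun x => (ofFun_apply _ _ _ x).trans <|
    (ofFun_apply _ _ _ (φ x)).trans <|
    (φ.invFun_apply x).trans (ofFun_apply (k := k) (fun x => x) _ _ x).symm

@[simp] theorem mul_apply (φ ψ : DiffC0 d k) (x : Eucl d) : (φ * ψ) x = φ (ψ x) :=
  ofFun_apply _ _ _ x

@[simp] theorem one_apply (x : Eucl d) : (1 : DiffC0 d k) x = x :=
  ofFun_apply _ _ _ x

/-- The inclusion `Diff_{C_0^m}(ℝ^d) → Diff_{C_0^k}(ℝ^d)` for `k ≤ m`. -/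
def incl {m : ℕ} [NeZero m] (h : k ≤ m) : DiffC0 d m →* DiffC0 d k where
  toFun φ := ⟨C0Map.incl h φ.1, φ.2⟩
  map_one' := rfl
  map_mul' _ _ := rfl

@[simp] theorem incl_apply {m : ℕ} [NeZero m] (h : k ≤ m) (φ : DiffC0 d m) (x : Eucl d) :
    (incl h φ) x = φ x := rfl

end DiffC0

/-! ### The group `𝒢^m = G ⋉ Diff_{C_0^m}(ℝ^d)` -/

/-- A lift of an action of `G` on `ℝ^d` to a continuous right action `ρ` of `G` on
`Diff_{C_0^m}(ℝ^d)` by group automorphisms which are smooth diffeomorphisms (the inverse of `ρ g` is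
`ρ g⁻¹`, so it is smooth as well). By the last condition, `ρ` is determined by the action on `ℝ^d`. -/
structure LiftedAction (G : Type*) [Group G] [TopologicalSpace G] (d m : ℕ) [NeZero m]
    [MulAction G (Eucl d)] where
  ρ : G → MulAut (DiffC0 d m)
  continuous_ρ : Continuous fun p : G × DiffC0 d m => ρ p.1 p.2
  contMDiff_ρ : ∀ g, ContMDiff 𝓘(ℝ, C0Map d m) 𝓘(ℝ, C0Map d m) ∞ (ρ g)
  ρ_mul : ∀ g h φ, ρ (g * h) φ = ρ h (ρ g φ)
  smul_apply : ∀ g φ x, g⁻¹ • φ (g • x) = (ρ g φ) x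

namespace LiftedAction

variable {G : Type*} [Group G] [TopologicalSpace G] {d m : ℕ} [NeZero m] [MulAction G (Eucl d)]

theorem ρ_one (R : LiftedAction G d m) (φ : DiffC0 d m) : R.ρ 1 φ = φ := by
  apply (R.ρ 1).injective
  rw [← R.ρ_mul, one_mul]

end LiftedAction

/-- The semidirect product `𝒢^m = G ⋉ Diff_{C_0^m}(ℝ^d)`: the product manifold, with group law
`(g, φ) (g', φ') = (g g', ρ_{g'}(φ) ∘ φ')`. -/
def DeformationGroup {G : Type*} [Group G] [TopologicalSpace G] {d m : ℕ} [NeZero m]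
    [MulAction G (Eucl d)] (_R : LiftedAction G d m) : Type _ := G × DiffC0 d m

namespace DeformationGroup

variable {G : Type*} [Group G] [TopologicalSpace G] {d m : ℕ} [NeZero m] [MulAction G (Eucl d)]
  {R : LiftedAction G d m}

instance : TopologicalSpace (DeformationGroup R) :=
  inferInstanceAs (TopologicalSpace (G × DiffC0 d m))

instance {EG : Type*} [NormedAddCommGroup EG] [ChartedSpace EG G] :
    ChartedSpace (ModelProd EG (C0Map d m)) (DeformationGroup R) :=
  inferInstanceAs (ChartedSpace (ModelProd EG (C0Map d m)) (G × DiffC0 d m))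

instance {EG : Type*} [NormedAddCommGroup EG] [NormedSpace ℝ EG] [ChartedSpace EG G]
    [IsManifold 𝓘(ℝ, EG) ∞ G] :
    IsManifold (𝓘(ℝ, EG).prod 𝓘(ℝ, C0Map d m)) ∞ (DeformationGroup R) :=
  inferInstanceAs (IsManifold (𝓘(ℝ, EG).prod 𝓘(ℝ, C0Map d m)) ∞ (G × DiffC0 d m))

/-- The component in `G`. -/
def fst (γ : DeformationGroup R) : G := Prod.fst γ

/-- The component in `Diff_{C_0^m}(ℝ^d)`. -/
def snd (γ : DeformationGroup R) : DiffC0 d m := Prod.snd γ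

/-- The element `(g, φ)`. -/
def mk (g : G) (φ : DiffC0 d m) : DeformationGroup R := Prod.mk g φ

instance : Group (DeformationGroup R) where
  mul γ γ' := mk (γ.fst * γ'.fst) (R.ρ γ'.fst γ.snd * γ'.snd)
  one := mk 1 1
  inv γ := mk γ.fst⁻¹ (R.ρ γ.fst⁻¹ γ.snd)⁻¹
  mul_assoc a b c := by
    refine Prod.ext (mul_assoc a.fst b.fst c.fst) ?_
    change R.ρ c.fst (R.ρ b.fst a.snd * b.snd) * c.snd
      = R.ρ (b.fst * c.fst) a.snd * (R.ρ c.fst b.snd * c.snd)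
    rw [map_mul, R.ρ_mul, mul_assoc]
  one_mul a := by
    refine Prod.ext (one_mul a.fst) ?_
    change R.ρ a.fst 1 * a.snd = a.snd
    rw [map_one, one_mul]
  mul_one a := by
    refine Prod.ext (mul_one a.fst) ?_
    change R.ρ 1 a.snd * 1 = a.snd
    rw [R.ρ_one, mul_one]
  inv_mul_cancel a := by
    refine Prod.ext (inv_mul_cancel a.fst) ?_
    change R.ρ a.fst (R.ρ a.fst⁻¹ a.snd)⁻¹ * a.snd = 1
    rw [map_inv, ← R.ρ_mul, inv_mul_cancel, R.ρ_one, inv_mul_cancel]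

/-- The inclusion `𝒢^m → 𝒢^k` for `k ≤ m`. -/
def incl {k : ℕ} [NeZero k] (h : k ≤ m) (R : LiftedAction G d m) (S : LiftedAction G d k) :
    DeformationGroup R →* DeformationGroup S where
  toFun γ := mk γ.fst (DiffC0.incl h γ.snd)
  map_one' := rfl
  map_mul' a b := by
    refine Prod.ext rfl ?_
    change DiffC0.incl h (R.ρ b.fst a.snd * b.snd)
      = S.ρ b.fst (DiffC0.incl h a.snd) * DiffC0.incl h b.snd
    have e : DiffC0.incl h (R.ρ b.fst a.snd) = S.ρ b.fst (DiffC0.incl h a.snd) :=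
      DiffC0.ext_fun fun x =>
        (R.smul_apply b.fst a.snd x).symm.trans (S.smul_apply b.fst (DiffC0.incl h a.snd) x)
    rw [map_mul, e]

end DeformationGroup

/-! ### Actions on shape spaces -/

section Actions

variable {EG : Type*} [NormedAddCommGroup EG] [NormedSpace ℝ EG]
  {EQ : Type*} [NormedAddCommGroup EQ] [NormedSpace ℝ EQ]
  {Q : Type*} [TopologicalSpace Q] [ChartedSpace EQ Q]

/-- The infinitesimal action `u · q = ∂_φ|_{φ = id} (φ · q) (u)` of `u ∈ C_0^k(ℝ^d, ℝ^d)`. -/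
def diffInfinitesimal {d k : ℕ} [NeZero k] [MulAction (DiffC0 d k) Q] (u : C0Map d k) (q : Q) :
    TangentSpace 𝓘(ℝ, EQ) q :=
  (mfderiv 𝓘(ℝ, C0Map d k) 𝓘(ℝ, EQ) (fun φ : DiffC0 d k => φ • q) 1 :
    C0Map d k →L[ℝ] EQ) u

/-- The infinitesimal action `X · q = ∂_g|_{g = e} (g · q) (X)` of
`X ∈ 𝔤 = T_e G`, a vector space which is by definition the model space `EG` of `G`. -/
def lieInfinitesimal (G : Type*) [Group G] [TopologicalSpace G] [ChartedSpace EG G]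
    [MulAction G Q] (X : EG) (q : Q) : TangentSpace 𝓘(ℝ, EQ) q :=
  (mfderiv 𝓘(ℝ, EG) 𝓘(ℝ, EQ) (fun g : G => g • q) 1 : EG →L[ℝ] EQ) X

/-- The regularity conditions on an action of `Diff_{C_0^k}(ℝ^d)` on a Banach manifold `Q`. -/
structure IsShapeAction (EQ : Type*) [NormedAddCommGroup EQ] [NormedSpace ℝ EQ]
    (Q : Type*) [TopologicalSpace Q] [ChartedSpace EQ Q] [IsManifold 𝓘(ℝ, EQ) ∞ Q]
    (d k : ℕ) [NeZero k] [MulAction (DiffC0 d k) Q] : Prop where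
  /-- the action is continuous -/
  continuous_smul : Continuous fun p : DiffC0 d k × Q => p.1 • p.2
  /-- the orbit maps are smooth -/
  contMDiff_orbit : ∀ q : Q,
    ContMDiff 𝓘(ℝ, C0Map d k) 𝓘(ℝ, EQ) ∞ fun φ : DiffC0 d k => φ • q
  /-- the action of `Diff_{C_0^{k+l}}(ℝ^d)` is of class `C^l` -/
  contMDiff_smul : ∀ l : ℕ, 0 < l →
    ContMDiff (𝓘(ℝ, C0Map d (k + l)).prod 𝓘(ℝ, EQ)) 𝓘(ℝ, EQ) l
      fun p : DiffC0 d (k + l) × Q => DiffC0.incl (Nat.le_add_right k l) p.1 • p.2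
  /-- the infinitesimal action of `C_0^{k+l}(ℝ^d, ℝ^d)` is of class `C^l` -/
  contMDiff_infinitesimal : ∀ l : ℕ, 0 < l →
    ContMDiff (𝓘(ℝ, C0Map d (k + l)).prod 𝓘(ℝ, EQ)) 𝓘(ℝ, EQ).tangent l
      fun p : C0Map d (k + l) × Q =>
        (⟨p.2, diffInfinitesimal (C0Map.incl (Nat.le_add_right k l) p.1) p.2⟩ :
          TangentBundle 𝓘(ℝ, EQ) Q)

variable {G : Type*} [Group G] [TopologicalSpace G] [ChartedSpace EG G]
  {d k : ℕ} [NeZero k] [MulAction G (Eucl d)] [MulAction G Q] [MulAction (DiffC0 d k) Q]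

/-- The map `A((g, φ), (h, q)) = (g h, g · (φ · q))` from `𝒢^k × (G × Q)` to `G × Q`. -/
def augAction {R : LiftedAction G d k} (γ : DeformationGroup R) (x : G × Q) : G × Q :=
  (γ.fst * x.1, γ.fst • (γ.snd • x.2))

/-- The infinitesimal action `ξ_x(X, u) = d_{(e, id)} A_x (X, u)`, where `A_x = A(·, x)`, for
`(X, u) ∈ T_e G × C_0^k(ℝ^d, ℝ^d) = T_{(e, id)} 𝒢^k`. -/
def augInfinitesimal (R : LiftedAction G d k) (Y : EG × C0Map d k)
    (x : G × Q) : TangentSpace (𝓘(ℝ, EG).prod 𝓘(ℝ, EQ)) x :=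
  (mfderiv (𝓘(ℝ, EG).prod 𝓘(ℝ, C0Map d k)) (𝓘(ℝ, EG).prod 𝓘(ℝ, EQ))
    (fun γ : DeformationGroup R => augAction γ x) 1 : EG × C0Map d k →L[ℝ] EG × EQ) Y

end Actions

end ShapeSpace

end

open ShapeSpace

/-! The map `A` is the partial action `(φ, q) ↦ φ · q` followed by `B(g, (h, q)) = (g h, g · q)`.
Multiplication in `G` and the action of `G` on `Q` are jointly `C^∞`, so `B` is smooth and costs no
derivative. Continuity of `A`, smoothness of its orbit maps and the class `C^l` after restriction to
`𝒢^{k+l}` are therefore inherited from the diffeomorphism action (`contMDiff_mul_smul`). The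
compatibility of the two actions on `Q` is exactly what the semidirect product law requires for `A`
to be an action.

The formula for `ξ` (`augInfinitesimal_apply`) is the splitting of a derivative on a product into
partial derivatives at `(e, id)`: freezing `φ = id` leaves the orbit map of `G`, and freezing `g =
e` leaves that of the diffeomorphism group.

For the regularity of `ξ` (`contMDiff_augInfinitesimal`), no sum of tangent vectors has to be
handled in charts: since `B(e, ·)` is the identity, `ξ_{(h,q)}(X, u) = TB(X_e, (0_h, u · q))`. The
tangent map `TB` is smooth, and its argument is a `C^l` function of the data because `(u, q) ↦ u ·
q` is. -/

/-- The inclusion of a fibre of the tangent bundle is smooth. -/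
theorem contMDiff_tangentFiber {E : Type*} [NormedAddCommGroup E] [NormedSpace ℝ E]
    {M : Type*} [TopologicalSpace M] [ChartedSpace E M] {n : WithTop ℕ∞}
    [IsManifold 𝓘(ℝ, E) 1 M] [IsManifold 𝓘(ℝ, E) (n + 1) M] (x : M) :
    ContMDiff 𝓘(ℝ, E) 𝓘(ℝ, E).tangent n
      fun v : E => (⟨x, v⟩ : TangentBundle 𝓘(ℝ, E) M) := by
  intro v
  rw [Bundle.contMDiffAt_totalSpace]
  refine ⟨contMDiffAt_const, ?_⟩
  -- The base point stays at `x`, so one trivialization serves for all vectors, and the fibre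
  -- coordinate is a fixed continuous linear map of the vector.
  have h : ContMDiff 𝓘(ℝ, E) 𝓘(ℝ, E) n fun w : E =>
      ((trivializationAt E (TangentSpace 𝓘(ℝ, E) : M → Type _) x).continuousLinearMapAt ℝ x :
        E →L[ℝ] E) w := ContinuousLinearMap.contMDiff _
  convert! h.contMDiffAt (x := v) using 2 with w
  rw [Bundle.Trivialization.continuousLinearMapAt_apply,
    Bundle.Trivialization.coe_linearMapAt_of_mem]
  exact FiberBundle.mem_baseSet_trivializationAt' x

namespace ShapeSpace

section

variable {d k : ℕ} [NeZero k]
  {EG : Type*} [NormedAddCommGroup EG] [NormedSpace ℝ EG]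
  {G : Type*} [TopologicalSpace G] [ChartedSpace EG G] [Group G]
  {EQ : Type*} [NormedAddCommGroup EQ] [NormedSpace ℝ EQ]
  {Q : Type*}

/-! ### The action axioms. -/

theorem augAction_one [MulAction G (Eucl d)] [MulAction (DiffC0 d k) Q] [MulAction G Q]
    (R : LiftedAction G d k) (x : G × Q) : augAction (1 : DeformationGroup R) x = x :=
  Prod.ext (one_mul x.1) ((one_smul G _).trans (one_smul (DiffC0 d k) x.2))

/-- On the `Q` component, `hcomp` moves `φ` past `g'`, turning it into `ρ_{g'}(φ)`; this is the
twist in the group law of `𝒢^k`. -/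
theorem augAction_mul [MulAction G (Eucl d)] [MulAction (DiffC0 d k) Q] [MulAction G Q]
    {R : LiftedAction G d k}
    (hcomp : ∀ (g : G) (φ : DiffC0 d k) (q : Q), φ • (g • q) = g • (R.ρ g φ • q))
    (γ γ' : DeformationGroup R) (x : G × Q) :
    augAction (γ * γ') x = augAction γ (augAction γ' x) := by
  refine Prod.ext (mul_assoc γ.fst γ'.fst x.1) ?_
  change (γ.fst * γ'.fst) • ((R.ρ γ'.fst γ.snd * γ'.snd) • x.2) =
    γ.fst • (γ.snd • (γ'.fst • (γ'.snd • x.2)))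
  rw [hcomp, mul_smul, mul_smul]

/-! ### Continuity of the action and smoothness of its orbit maps. -/

variable [TopologicalSpace Q] [ChartedSpace EQ Q] [LieGroup 𝓘(ℝ, EG) ∞ G]

/-- The smoothness of the map `((g, φ), (h, q)) ↦ (g h, g · (φ · q))` for a family of `φ` and `q`
depending on a parameter. -/
theorem contMDiff_mul_smul [MulAction G Q]
    (hGQ : ContMDiff (𝓘(ℝ, EG).prod 𝓘(ℝ, EQ)) 𝓘(ℝ, EQ) ∞ fun p : G × Q => p.1 • p.2)
    {E : Type*} [NormedAddCommGroup E] [NormedSpace ℝ E] {H : Type*} [TopologicalSpace H]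
    {I : ModelWithCorners ℝ E H} {M : Type*} [TopologicalSpace M] [ChartedSpace H M]
    {n : WithTop ℕ∞} (hn : n ≤ ∞) {g h : M → G} {q : M → Q}
    (hg : ContMDiff I 𝓘(ℝ, EG) n g) (hh : ContMDiff I 𝓘(ℝ, EG) n h)
    (hq : ContMDiff I 𝓘(ℝ, EQ) n q) :
    ContMDiff I (𝓘(ℝ, EG).prod 𝓘(ℝ, EQ)) n fun x => (g x * h x, g x • q x) :=
  ((((contMDiff_mul 𝓘(ℝ, EG) ∞).of_le hn).comp (hg.prodMk hh))).prodMk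
    ((hGQ.of_le hn).comp (hg.prodMk hq))

variable [IsManifold 𝓘(ℝ, EQ) ∞ Q]

theorem continuous_augAction [MulAction G (Eucl d)] [MulAction (DiffC0 d k) Q] [MulAction G Q]
    {R : LiftedAction G d k} (hDQ : IsShapeAction EQ Q d k)
    (hGQ : ContMDiff (𝓘(ℝ, EG).prod 𝓘(ℝ, EQ)) 𝓘(ℝ, EQ) ∞ fun p : G × Q => p.1 • p.2) :
    Continuous fun p : DeformationGroup R × (G × Q) => augAction p.1 p.2 := by
  change Continuous fun p : (G × DiffC0 d k) × (G × Q) =>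
    (p.1.1 * p.2.1, p.1.1 • (p.1.2 • p.2.2))
  have hmul : Continuous fun p : G × G => p.1 * p.2 := (contMDiff_mul 𝓘(ℝ, EG) ∞).continuous
  refine Continuous.prodMk ?_ ?_
  · exact hmul.comp (continuous_fst.fst.prodMk continuous_snd.fst)
  · exact hGQ.continuous.comp (continuous_fst.fst.prodMk
      (hDQ.continuous_smul.comp (continuous_fst.snd.prodMk continuous_snd.snd)))

theorem contMDiff_augAction_orbit [MulAction G (Eucl d)] [MulAction (DiffC0 d k) Q]
    [MulAction G Q] {R : LiftedAction G d k} (hDQ : IsShapeAction EQ Q d k)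
    (hGQ : ContMDiff (𝓘(ℝ, EG).prod 𝓘(ℝ, EQ)) 𝓘(ℝ, EQ) ∞ fun p : G × Q => p.1 • p.2)
    (x : G × Q) :
    ContMDiff (𝓘(ℝ, EG).prod 𝓘(ℝ, C0Map d k)) (𝓘(ℝ, EG).prod 𝓘(ℝ, EQ)) ∞
      fun γ : DeformationGroup R => augAction γ x :=
  -- The manifold structure of `DeformationGroup R` is by definition that of the product, so the
  -- projections of `G × DiffC0 d k` are available.
  contMDiff_mul_smul (M := G × DiffC0 d k) hGQ le_rfl contMDiff_fst contMDiff_const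
    ((hDQ.contMDiff_orbit x.2).comp contMDiff_snd)

/-! ### The infinitesimal action: formula and regularity. -/

/-- Each component of the orbit map is differentiated as the sum of its partial derivatives in `g`
and `φ`; the `G` component does not depend on `φ`, hence contributes only `X h`. -/
theorem augInfinitesimal_apply [MulAction G (Eucl d)] [MulAction (DiffC0 d k) Q]
    [MulAction G Q] (R : LiftedAction G d k) (hDQ : IsShapeAction EQ Q d k)
    (hGQ : ContMDiff (𝓘(ℝ, EG).prod 𝓘(ℝ, EQ)) 𝓘(ℝ, EQ) ∞ fun p : G × Q => p.1 • p.2)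
    (X : EG) (u : C0Map d k) (h : G) (q : Q) :
    (augInfinitesimal R (X, u) (h, q) : TangentSpace (𝓘(ℝ, EG).prod 𝓘(ℝ, EQ)) (h, q)) =
      ((mfderiv 𝓘(ℝ, EG) 𝓘(ℝ, EG) (fun g : G => g * h) 1 : EG →L[ℝ] EG) X,
        (lieInfinitesimal G X q + diffInfinitesimal u q : TangentSpace 𝓘(ℝ, EQ) q)) := by
  have h1 : MDifferentiableAt (𝓘(ℝ, EG).prod 𝓘(ℝ, C0Map d k)) 𝓘(ℝ, EG)
      (fun γ : G × DiffC0 d k => γ.1 * h) (1, 1) :=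
    (((contMDiff_mul 𝓘(ℝ, EG) ∞).comp (contMDiff_fst.prodMk contMDiff_const)).mdifferentiable
      (by simp)) _
  have h2 : MDifferentiableAt (𝓘(ℝ, EG).prod 𝓘(ℝ, C0Map d k)) 𝓘(ℝ, EQ)
      (fun γ : G × DiffC0 d k => γ.1 • (γ.2 • q)) (1, 1) :=
    ((hGQ.comp (contMDiff_fst.prodMk
      ((hDQ.contMDiff_orbit q).comp contMDiff_snd))).mdifferentiable (by simp)) _
  have e := mfderiv_prodMk h1 h2
  have e1 := mfderiv_prod_eq_add_apply (v := (X, u)) h1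
  have e2 := mfderiv_prod_eq_add_apply (v := (X, u)) h2
  -- The partial derivatives are those of `g ↦ g · (1 · q)` and `φ ↦ 1 · (φ · q)`. The type of
  -- `mfderiv` depends on the base point, so `1 · q` and `1 · _` are generalized to a point `q'` and
  -- a map `f`, and the equalities are then eliminated by substitution.
  have e3 : ∀ q' : Q, q' = q →
      (mfderiv 𝓘(ℝ, EG) 𝓘(ℝ, EQ) (fun g : G => g • q') 1 : EG →L[ℝ] EQ) X =
        lieInfinitesimal G X q := by
    rintro _ rfl
    rfl
  have e4 : ∀ f : Q → Q, f = id →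
      (mfderiv 𝓘(ℝ, C0Map d k) 𝓘(ℝ, EQ) (fun φ : DiffC0 d k => f (φ • q)) 1 :
        C0Map d k →L[ℝ] EQ) u = diffInfinitesimal u q := by
    rintro _ rfl
    rfl
  simp only [mfderiv_const] at e1
  refine Eq.trans (DFunLike.congr_fun e (X, u)) (Prod.ext (e1.trans (add_zero _)) ?_)
  exact e2.trans (congrArg₂ (fun a b : EQ => a + b) (e3 _ (one_smul _ q))
    (e4 _ (funext fun q' => one_smul G q')))

/-- The pair `(X h, X · q + u · q)` is recognized as the image under `TB` of the vector `(X, (0, u ·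
q))` at `(e, (h, q))`. Only the entry `u · q` is limited to class `C^l`. -/
theorem contMDiff_augInfinitesimal [MulAction G (Eucl d)] [MulAction (DiffC0 d k) Q]
    [MulAction G Q] (R : LiftedAction G d k) (hDQ : IsShapeAction EQ Q d k)
    (hGQ : ContMDiff (𝓘(ℝ, EG).prod 𝓘(ℝ, EQ)) 𝓘(ℝ, EQ) ∞ fun p : G × Q => p.1 • p.2)
    {l : ℕ} (hl : 0 < l) :
    ContMDiff (𝓘(ℝ, EG × C0Map d (k + l)).prod
        (𝓘(ℝ, EG).prod 𝓘(ℝ, EQ))) (𝓘(ℝ, EG).prod 𝓘(ℝ, EQ)).tangent l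
      fun p : (EG × C0Map d (k + l)) × (G × Q) =>
        (⟨p.2, augInfinitesimal R (p.1.1, C0Map.incl (Nat.le_add_right k l) p.1.2) p.2⟩ :
          TangentBundle (𝓘(ℝ, EG).prod 𝓘(ℝ, EQ)) (G × Q)) := by
  have : IsManifold 𝓘(ℝ, EG) ∞ G := inferInstance
  have : IsManifold 𝓘(ℝ, EG) 1 G := .of_le (n := ∞) (by simp)
  have : IsManifold 𝓘(ℝ, EQ) 1 Q := .of_le (n := ∞) (by simp)
  -- The tangent bundle has one degree of smoothness less than the manifold, whence `l + 1`.
  have : IsManifold 𝓘(ℝ, EG) ((l : WithTop ℕ∞) + 1) G :=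
    .of_le (n := ∞) (by exact_mod_cast le_top)
  have hB : ContMDiff (𝓘(ℝ, EG).prod (𝓘(ℝ, EG).prod 𝓘(ℝ, EQ))) (𝓘(ℝ, EG).prod 𝓘(ℝ, EQ)) ∞
      fun p : G × (G × Q) => (p.1 * p.2.1, p.1 • p.2.2) :=
    contMDiff_mul_smul hGQ le_rfl contMDiff_fst contMDiff_snd.fst contMDiff_snd.snd
  -- The pairs `(X, u)` range over a normed space with its own trivial model, not a product of
  -- models, so `X` and `u` are extracted by continuous linear projections.
  have hX : ContMDiff (𝓘(ℝ, EG × C0Map d (k + l)).prod (𝓘(ℝ, EG).prod 𝓘(ℝ, EQ)))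
      𝓘(ℝ, EG).tangent l fun p : (EG × C0Map d (k + l)) × (G × Q) =>
        (⟨1, p.1.1⟩ : TangentBundle 𝓘(ℝ, EG) G) :=
    (contMDiff_tangentFiber (1 : G)).comp
      ((ContinuousLinearMap.fst ℝ EG (C0Map d (k + l))).contMDiff.comp contMDiff_fst)
  have h0 : ContMDiff (𝓘(ℝ, EG × C0Map d (k + l)).prod (𝓘(ℝ, EG).prod 𝓘(ℝ, EQ)))
      𝓘(ℝ, EG).tangent l fun p : (EG × C0Map d (k + l)) × (G × Q) =>
        (⟨p.2.1, 0⟩ : TangentBundle 𝓘(ℝ, EG) G) :=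
    (Bundle.contMDiff_zeroSection ℝ (TangentSpace 𝓘(ℝ, EG) : G → Type _)).comp contMDiff_snd.fst
  have hu : ContMDiff (𝓘(ℝ, EG × C0Map d (k + l)).prod (𝓘(ℝ, EG).prod 𝓘(ℝ, EQ)))
      𝓘(ℝ, EQ).tangent l fun p : (EG × C0Map d (k + l)) × (G × Q) =>
        (⟨p.2.2, diffInfinitesimal (C0Map.incl (Nat.le_add_right k l) p.1.2) p.2.2⟩ :
          TangentBundle 𝓘(ℝ, EQ) Q) :=
    (hDQ.contMDiff_infinitesimal l hl).comp
      (((ContinuousLinearMap.snd ℝ EG (C0Map d (k + l))).contMDiff.comp contMDiff_fst).prodMk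
        contMDiff_snd.snd)
  -- The three tangent vectors are assembled by `T(M × N) ≃ TM × TN`, used once for `G × Q` and once
  -- for `G × (G × Q)`.
  have hT := (hB.contMDiff_tangentMap (m := l) (by exact_mod_cast le_top)).comp
    (contMDiff_equivTangentBundleProd_symm.comp
      (hX.prodMk (contMDiff_equivTangentBundleProd_symm.comp (h0.prodMk hu))))
  convert! hT using 1
  funext p
  obtain ⟨⟨X, u⟩, h, q⟩ := p
  -- The base points `(h, q)` and `(1 * h, 1 • q)` are only propositionally equal, but every fibre
  -- is the model space `EG × EQ`, where the vectors can be compared.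
  have hext : ∀ (x x' : G × Q) (v v' : EG × EQ), x = x' → v = v' →
      (⟨x, v⟩ : TangentBundle (𝓘(ℝ, EG).prod 𝓘(ℝ, EQ)) (G × Q)) = ⟨x', v'⟩ := by
    rintro x _ v _ rfl rfl
    rfl
  have hBd : ∀ x, MDifferentiableAt (𝓘(ℝ, EG).prod (𝓘(ℝ, EG).prod 𝓘(ℝ, EQ)))
      (𝓘(ℝ, EG).prod 𝓘(ℝ, EQ)) (fun p : G × (G × Q) => (p.1 * p.2.1, p.1 • p.2.2)) x :=
    hB.mdifferentiable (by simp)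
  let w : EG × EQ := (0, diffInfinitesimal (C0Map.incl (Nat.le_add_right k l) u) q)
  have e := mfderiv_prod_eq_add_apply (v := (X, w)) (hBd (1, (h, q)))
  have e1 := DFunLike.congr_fun (mfderiv_prodMk
    (((contMDiff_mul 𝓘(ℝ, EG) ∞).comp
      (contMDiff_id.prodMk (contMDiff_const (c := h)))).mdifferentiable (by simp) (1 : G))
    ((hGQ.comp (contMDiff_id.prodMk (contMDiff_const (c := q)))).mdifferentiable
      (by simp) (1 : G))) X
  -- With `g = e` frozen, `B` is the identity of `G × Q`, so its partial derivative returns `w`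
  -- unchanged.
  have e2 : ∀ f : G × Q → G × Q, f = id →
      (mfderiv (𝓘(ℝ, EG).prod 𝓘(ℝ, EQ)) (𝓘(ℝ, EG).prod 𝓘(ℝ, EQ)) f (h, q) :
        EG × EQ →L[ℝ] EG × EQ) w = w := by
    rintro _ rfl
    rw [mfderiv_id]
    rfl
  refine hext _ _ _ _ (Prod.ext (one_mul h).symm (one_smul G q).symm) ?_
  refine (augInfinitesimal_apply R hDQ hGQ X _ h q).trans (Eq.symm ?_)
  refine e.trans ((congrArg₂ (fun a b : EG × EQ => a + b) e1
    (e2 _ (funext fun y => Prod.ext (one_mul y.1) (one_smul G y.2)))).trans ?_)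
  exact Prod.ext (add_zero _) rfl

/-! ### Regularity of the restricted action. -/

theorem contMDiff_augAction [MulAction G (Eucl d)] [MulAction (DiffC0 d k) Q]
    [MulAction G Q] (R : LiftedAction G d k) (hDQ : IsShapeAction EQ Q d k)
    (hGQ : ContMDiff (𝓘(ℝ, EG).prod 𝓘(ℝ, EQ)) 𝓘(ℝ, EQ) ∞ fun p : G × Q => p.1 • p.2)
    {l : ℕ} (hl : 0 < l) (R' : LiftedAction G d (k + l)) :
    ContMDiff ((𝓘(ℝ, EG).prod 𝓘(ℝ, C0Map d (k + l))).prod (𝓘(ℝ, EG).prod 𝓘(ℝ, EQ)))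
      (𝓘(ℝ, EG).prod 𝓘(ℝ, EQ)) l
      fun p : DeformationGroup R' × (G × Q) =>
        augAction (DeformationGroup.incl (Nat.le_add_right k l) R' R p.1) p.2 := by
  have h : ContMDiff ((𝓘(ℝ, EG).prod 𝓘(ℝ, C0Map d (k + l))).prod (𝓘(ℝ, EG).prod 𝓘(ℝ, EQ)))
      (𝓘(ℝ, EG).prod 𝓘(ℝ, EQ)) l fun p : (G × DiffC0 d (k + l)) × (G × Q) =>
        (p.1.1 * p.2.1, p.1.1 • (DiffC0.incl (Nat.le_add_right k l) p.1.2 • p.2.2)) :=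
    contMDiff_mul_smul hGQ (by exact_mod_cast le_top) contMDiff_fst.fst contMDiff_snd.fst
      ((hDQ.contMDiff_smul l hl).comp (contMDiff_fst.snd.prodMk contMDiff_snd.snd))
  -- The inclusion `𝒢^{k+l} → 𝒢^k` keeps `g` and includes `φ`, so both maps agree by definition.
  exact h

end

end ShapeSpace

theorem mainTheorem5
    -- `k ≥ 1`, a finite-dimensional Lie group `G` acting smoothly on `ℝ^d`
    {d k : ℕ} [NeZero k]
    {EG : Type*} [NormedAddCommGroup EG] [NormedSpace ℝ EG] [FiniteDimensional ℝ EG]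
    {G : Type*} [TopologicalSpace G] [ChartedSpace EG G] [Group G] [LieGroup 𝓘(ℝ, EG) ∞ G]
    [MulAction G (Eucl d)]
    (hGd : ContMDiff (𝓘(ℝ, EG).prod 𝓘(ℝ, Eucl d)) 𝓘(ℝ, Eucl d) ∞
      fun p : G × Eucl d => p.1 • p.2)
    -- the lifts of the action to `Diff_{C_0^k}` and to all `Diff_{C_0^{k+l}}`
    (R : LiftedAction G d k) (R' : ∀ l : ℕ, LiftedAction G d (k + l))
    -- the Banach manifold `Q`, with its actions of `Diff_{C_0^k}` and of `G`
    {EQ : Type*} [NormedAddCommGroup EQ] [NormedSpace ℝ EQ] [CompleteSpace EQ]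
    {Q : Type*} [TopologicalSpace Q] [ChartedSpace EQ Q] [IsManifold 𝓘(ℝ, EQ) ∞ Q]
    [MulAction (DiffC0 d k) Q] (hDQ : IsShapeAction EQ Q d k)
    [MulAction G Q]
    (hGQ : ContMDiff (𝓘(ℝ, EG).prod 𝓘(ℝ, EQ)) 𝓘(ℝ, EQ) ∞ fun p : G × Q => p.1 • p.2)
    (hcomp : ∀ (g : G) (φ : DiffC0 d k) (q : Q), φ • (g • q) = g • (R.ρ g φ • q)) :
    -- `A` is an action of the group `𝒢^k` on `G × Q`
    ((∀ x : G × Q, augAction (1 : DeformationGroup R) x = x) ∧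
      ∀ (γ γ' : DeformationGroup R) (x : G × Q),
        augAction (γ * γ') x = augAction γ (augAction γ' x)) ∧
    -- it is continuous
    (Continuous fun p : DeformationGroup R × (G × Q) => augAction p.1 p.2) ∧
    -- its orbit maps are smooth
    (∀ x : G × Q, ContMDiff (𝓘(ℝ, EG).prod 𝓘(ℝ, C0Map d k)) (𝓘(ℝ, EG).prod 𝓘(ℝ, EQ)) ∞
      fun γ : DeformationGroup R => augAction γ x) ∧
    -- the infinitesimal action is `ξ_{(h, q)}(X, u) = (X h, X · q + u · q)`
    (∀ (X : EG) (u : C0Map d k) (h : G) (q : Q),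
      (augInfinitesimal R (X, u) (h, q) : TangentSpace (𝓘(ℝ, EG).prod 𝓘(ℝ, EQ)) (h, q)) =
        ((mfderiv 𝓘(ℝ, EG) 𝓘(ℝ, EG) (fun g : G => g * h) 1 : EG →L[ℝ] EG) X,
          (lieInfinitesimal G X q + diffInfinitesimal u q : TangentSpace 𝓘(ℝ, EQ) q))) ∧
    -- the restriction of `A` to `𝒢^{k+l}`, and that of `ξ` to `T_{(e, id)} 𝒢^{k+l}`, are `C^l`
    (∀ l : ℕ, 0 < l →
      (ContMDiff ((𝓘(ℝ, EG).prod 𝓘(ℝ, C0Map d (k + l))).prod (𝓘(ℝ, EG).prod 𝓘(ℝ, EQ)))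
        (𝓘(ℝ, EG).prod 𝓘(ℝ, EQ)) l
        fun p : DeformationGroup (R' l) × (G × Q) =>
          augAction (DeformationGroup.incl (Nat.le_add_right k l) (R' l) R p.1) p.2) ∧
      (ContMDiff (𝓘(ℝ, EG × C0Map d (k + l)).prod
          (𝓘(ℝ, EG).prod 𝓘(ℝ, EQ))) (𝓘(ℝ, EG).prod 𝓘(ℝ, EQ)).tangent l
        fun p : (EG × C0Map d (k + l)) × (G × Q) =>
          (⟨p.2, augInfinitesimal R (p.1.1, C0Map.incl (Nat.le_add_right k l) p.1.2) p.2⟩ :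
            TangentBundle (𝓘(ℝ, EG).prod 𝓘(ℝ, EQ)) (G × Q)))) := by
  exact ⟨⟨augAction_one R, augAction_mul hcomp⟩, continuous_augAction hDQ hGQ,
    contMDiff_augAction_orbit hDQ hGQ, augInfinitesimal_apply R hDQ hGQ,
    fun l hl => ⟨contMDiff_augAction R hDQ hGQ hl (R' l),
      contMDiff_augInfinitesimal R hDQ hGQ hl⟩⟩
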